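/- Let $K(d)$ be the kissing number in dimension $d$, i.e. the maximum number of pairwise non-overlapping unit spheres in $\mathbb{R}^d$ that can touch a single unit sphere (without overlapping it). Let $A(d,\theta)$ be the maximum size of a spherical code of angle $\theta$ in dimension $d$, i.e. of a set of unit vectors in $\mathbb{R}^d$ with $\langle x,y\rangle\le\cos\theta$ for all distinct $x,y$ in the set. Then $K(d)=A(d,\pi/3)$ for every $d$, and $$K(d)\ \ge\ (1+o(1))\,\sqrt{\frac{3\pi}{8}}\,\log\frac{3}{2\sqrt2}\cdot d^{3/2}\left(\frac{2}{\sqrt3}\right)^{d}\qquad\text{as } d\to\infty;$$ that is, there is a sequence $\varepsilon_d\to 0$ such that for all sufficiently large $d$ the number $K(d)$ is at least $(1+\varepsilon_d)\sqrt{3\pi/8}\,\log\bigl(3/(2\sqrt2)\bigr)\,d^{3/2}(2/\sqrt3)^d$. The constant $\sqrt{3\pi/8}\,\log\bigl(3/(2\sqrt2)\bigr)$ is approximately $0.0639$ (it differs from $0.0639$ by less than $0.00005$). -/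

import Mathlib

open Filter Topology

/-- `C` is the set of centres of a kissing configuration in dimension `d`: the unit spheres centred
at the points of `C` all touch the unit sphere centred at the origin, and no two of all these unit
spheres (the central one included) overlap, that is, the open unit balls are pairwise disjoint. -/
structure IsKissingConfiguration (d : ℕ) (C : Finset (EuclideanSpace ℝ (Fin d))) : Prop where
  touches : ∀ x ∈ C, (Metric.sphere x 1 ∩ Metric.sphere 0 1).Nonempty
  disjoint_central : ∀ x ∈ C, Disjoint (Metric.ball x 1) (Metric.ball 0 1)
  pairwise_disjoint : ∀ x ∈ C, ∀ y ∈ C, x ≠ y → Disjoint (Metric.ball x 1) (Metric.ball y 1)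

/-- The kissing number `K(d)`: the maximum number of non-overlapping unit spheres that can touch a
single unit sphere in dimension `d`. -/
noncomputable def kissingNumber (d : ℕ) : ℕ :=
  sSup {k : ℕ | ∃ C : Finset (EuclideanSpace ℝ (Fin d)), IsKissingConfiguration d C ∧ C.card = k}

/-- `C` is a spherical code of angle `θ` in dimension `d`: a finite set of unit vectors with
`⟨x, y⟩ ≤ cos θ` for all distinct `x, y` in it. -/
structure IsSphericalCode (d : ℕ) (θ : ℝ) (C : Finset (EuclideanSpace ℝ (Fin d))) : Prop where
  mem_sphere : ∀ x ∈ C, x ∈ Metric.sphere (0 : EuclideanSpace ℝ (Fin d)) 1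
  inner_le : ∀ x ∈ C, ∀ y ∈ C, x ≠ y → inner ℝ x y ≤ Real.cos θ

/-- `A(d, θ)`: the size of the largest spherical code of angle `θ` in dimension `d`
(for `0 < θ ≤ π`). -/
noncomputable def maxSphericalCode (d : ℕ) (θ : ℝ) : ℕ :=
  sSup {k : ℕ | ∃ C : Finset (EuclideanSpace ℝ (Fin d)), IsSphericalCode d θ C ∧ C.card = k}

/-- Finite subsets of a compact set whose points are uniformly separated have bounded size. -/
theorem exists_card_le_of_separated {X : Type*} [PseudoMetricSpace X] {K : Set X}
    (hK : IsCompact K) {r : ℝ} (hr : 0 < r) :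
    ∃ N : ℕ, ∀ C : Finset X, (∀ x ∈ C, x ∈ K) → (∀ x ∈ C, ∀ y ∈ C, x ≠ y → r ≤ dist x y) →
      C.card ≤ N := by
  classical
  obtain ⟨t, -, ht, hcov⟩ := hK.finite_cover_balls (half_pos hr)
  refine ⟨ht.toFinset.card, fun C hCK hC => ?_⟩
  have h : ∀ x ∈ C, ∃ c ∈ t, dist x c < r / 2 := fun x hx => by
    simpa using hcov (hCK x hx)
  choose! f hf hfd using h
  refine Finset.card_le_card_of_injOn f (fun x hx => by simpa using hf x hx) ?_
  intro x hx y hy hxy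
  by_contra hne
  have h1 := hC x hx y hy hne
  have h2 := hfd x hx
  have h3 := hfd y hy
  rw [← hxy] at h3
  linarith [dist_triangle_right x y (f x)]

/-- The kissing number is an attained maximum. -/
theorem isGreatest_kissingNumber (d : ℕ) :
    IsGreatest {k : ℕ | ∃ C : Finset (EuclideanSpace ℝ (Fin d)),
      IsKissingConfiguration d C ∧ C.card = k} (kissingNumber d) := by
  have hb : BddAbove {k : ℕ | ∃ C : Finset (EuclideanSpace ℝ (Fin d)),
      IsKissingConfiguration d C ∧ C.card = k} := by
    obtain ⟨N, hN⟩ := exists_card_le_of_separated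
      (isCompact_closedBall (0 : EuclideanSpace ℝ (Fin d)) 2) one_pos
    refine ⟨N, ?_⟩
    rintro k ⟨C, hC, rfl⟩
    refine hN C (fun x hx => ?_) (fun x hx y hy hxy => ?_)
    · obtain ⟨z, hz1, hz2⟩ := hC.touches x hx
      rw [Metric.mem_sphere] at hz1 hz2
      rw [Metric.mem_closedBall]
      linarith [dist_triangle_left x 0 z]
    · by_contra hlt
      rw [not_le] at hlt
      exact Set.disjoint_left.1 (hC.pairwise_disjoint x hx y hy hxy)
        (Metric.mem_ball_self one_pos) hlt
  exact ⟨Nat.sSup_mem ⟨0, ∅, ⟨by simp, by simp, by simp⟩, rfl⟩ hb, fun k hk => le_csSup hb hk⟩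

/-- For `0 < θ ≤ π`, the number `A(d, θ)` is an attained maximum. -/
theorem isGreatest_maxSphericalCode (d : ℕ) {θ : ℝ} (h0 : 0 < θ) (hπ : θ ≤ Real.pi) :
    IsGreatest {k : ℕ | ∃ C : Finset (EuclideanSpace ℝ (Fin d)),
      IsSphericalCode d θ C ∧ C.card = k} (maxSphericalCode d θ) := by
  have hcos : Real.cos θ < 1 := by
    simpa using Real.cos_lt_cos_of_nonneg_of_le_pi le_rfl hπ h0
  have hb : BddAbove {k : ℕ | ∃ C : Finset (EuclideanSpace ℝ (Fin d)),
      IsSphericalCode d θ C ∧ C.card = k} := by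
    obtain ⟨N, hN⟩ := exists_card_le_of_separated
      (isCompact_sphere (0 : EuclideanSpace ℝ (Fin d)) 1)
      (Real.sqrt_pos.2 (by linarith : 0 < 2 - 2 * Real.cos θ))
    refine ⟨N, ?_⟩
    rintro k ⟨C, hC, rfl⟩
    refine hN C hC.mem_sphere (fun x hx y hy hxy => ?_)
    have hx1 : ‖x‖ = 1 := by simpa using hC.mem_sphere x hx
    have hy1 : ‖y‖ = 1 := by simpa using hC.mem_sphere y hy
    rw [dist_eq_norm]
    refine Real.sqrt_le_iff.2 ⟨norm_nonneg _, ?_⟩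
    rw [norm_sub_sq_real, hx1, hy1]
    linarith [hC.inner_le x hx y hy hxy]
  exact ⟨Nat.sSup_mem ⟨0, ∅, ⟨by simp, by simp⟩, rfl⟩ hb, fun k hk => le_csSup hb hk⟩

/-!
The lower bound on the kissing number is proved with the hard-core model, that is, a random
independent set in which a set `I` has weight `∏ v ∈ I, a v`.

Replace the sphere by a fine finite net whose points `v` carry the normalised measures `w v` of
small cells, and join two points if their angle is less than `π / 3`. Independent sets are spherical codes
of angle `π / 3`, so the largest one is at least the expected size `α` of a hard-core random set `I`
with activities `a v = l * w v`. Fix `v` and reveal `I` outside the closed neighbourhood `N(v)`. What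
is left is a hard-core set on the unblocked part `T ⊆ N(v)` (`sum_indepSets_inter`). With
`x = a(T)`, two estimates hold.

* `N(v)` stays empty with conditional probability `1 / Z(T) ≥ exp (-x)` (`partitionFn_le_exp`), and
  `α` is the sum over `v` of `a v` times the probability that `N(v)` is empty (`sizeSum_eq`).
* `N(v)` contains on average at least `(1 - 2 D) x` points of `I`, where `D` bounds the activity of
  the common neighbours of `v` and `u` that are at least as close to `v` as `u` is
  (`partitionFn_mul_le_sizeSum`, `sum_pairs_le`). The sum over `v` of `a v` times the expected number
  of points in `N(v)` is at most `Δ α`, where `Δ` bounds the activity of a closed neighbourhood.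

A small `x` makes the first quantity large and a large `x` the second, and replacing `exp (-x)` by
its tangent line at `c` gives `(1 + c) a(V) ≤ |I| (exp c + Δ / (1 - 2 D))` for some independent set
`I` (`exists_large_indepSet`).

On the sphere, up to an arbitrarily small loss from the discretisation (`exists_weighted_net`),
`Δ / l` is the measure of a cap of height `1 / 2`, and `D / l` is at most the measure of a cap of
height `1 / √3` (`exists_cap_of_inter`). Only upper bounds on cap measures are needed,
but the first has to be asymptotically sharp: `measureReal_sector_le` integrates slices of a sector of
the ball and compares consecutive ball volumes through the log-convexity of the Gamma function. In
dimension `d` the quotient of the two caps is `(3 / (2 * √2)) ^ d` up to a bounded factor, so that the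
fugacity `l` can be chosen with `2 D = 1 / d` and `c = d log (3 / (2 * √2)) - O(log d)`, whence
`(1 + o(1)) d log (3 / (2 * √2))` over the measure of a cap of height `1 / 2` as a lower bound.
-/

/-! ### The hard-core model on a finite graph -/

open Classical in
/-- The finsets contained in `S` whose distinct elements are never related by `R`. -/
noncomputable def indepSets {V : Type*} (R : V → V → Prop) (S : Finset V) : Finset (Finset V) :=
  S.powerset.filter fun I => ∀ x ∈ I, ∀ y ∈ I, x ≠ y → ¬ R x y

/-- The hard-core partition function of `S` with activities `a`. -/
noncomputable def partitionFn {V : Type*} (R : V → V → Prop) (a : V → ℝ) (S : Finset V) : ℝ :=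
  ∑ I ∈ indepSets R S, ∏ v ∈ I, a v

/-- The unnormalised expected size of a hard-core random independent set: the sum of
`|I| ∏ v ∈ I, a v`. -/
noncomputable def sizeSum {V : Type*} (R : V → V → Prop) (a : V → ℝ) (S : Finset V) : ℝ :=
  ∑ I ∈ indepSets R S, (I.card : ℝ) * ∏ v ∈ I, a v

section HardCore

variable {V : Type*} {R : V → V → Prop} {a : V → ℝ}

theorem mem_indepSets {S I : Finset V} :
    I ∈ indepSets R S ↔ I ⊆ S ∧ ∀ x ∈ I, ∀ y ∈ I, x ≠ y → ¬ R x y := by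
  simp [indepSets]

theorem indepSets_mono {S T : Finset V} (h : S ⊆ T) : indepSets R S ⊆ indepSets R T := by
  intro I hI
  rw [mem_indepSets] at hI ⊢
  exact ⟨hI.1.trans h, hI.2⟩

theorem partitionFn_mono (ha : ∀ v, 0 ≤ a v) {S T : Finset V} (h : S ⊆ T) :
    partitionFn R a S ≤ partitionFn R a T :=
  Finset.sum_le_sum_of_subset_of_nonneg (indepSets_mono h)
    fun _ _ _ => Finset.prod_nonneg fun v _ => ha v

theorem partitionFn_pos (ha : ∀ v, 0 ≤ a v) (S : Finset V) : 0 < partitionFn R a S := by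
  have h : (∅ : Finset V) ∈ indepSets R S := by simp [mem_indepSets]
  have := Finset.single_le_sum (f := fun I : Finset V => ∏ v ∈ I, a v)
    (fun I _ => Finset.prod_nonneg fun v _ => ha v) h
  simp only [Finset.prod_empty] at this
  exact lt_of_lt_of_le one_pos this

theorem partitionFn_le_exp (ha : ∀ v, 0 ≤ a v) (S : Finset V) :
    partitionFn R a S ≤ Real.exp (∑ v ∈ S, a v) := by
  classical
  calc partitionFn R a S ≤ ∑ I ∈ S.powerset, ∏ v ∈ I, a v :=
        Finset.sum_le_sum_of_subset_of_nonneg (Finset.filter_subset _ _)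
          fun _ _ _ => Finset.prod_nonneg fun v _ => ha v
    _ = ∏ v ∈ S, (1 + a v) := (Finset.prod_one_add S).symm
    _ ≤ ∏ v ∈ S, Real.exp (a v) := Finset.prod_le_prod (fun v _ => by linarith [ha v])
          fun v _ => by linarith [Real.add_one_le_exp (a v)]
    _ = Real.exp (∑ v ∈ S, a v) := (Real.exp_sum S a).symm

open Classical in
/-- Removing `u` is a bijection from the independent sets of `S` containing `u` to the independent
sets of `S` avoiding the closed neighbourhood of `u`. -/
theorem sum_indepSets_mem (hR : ∀ x, R x x) (hs : ∀ x y, R x y → R y x) {S : Finset V} {u : V}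
    (hu : u ∈ S) :
    ∑ I ∈ indepSets R S with u ∈ I, ∏ v ∈ I, a v =
      a u * partitionFn R a (S.filter fun y => ¬ R u y) := by
  rw [partitionFn, Finset.mul_sum]
  refine Finset.sum_bij' (fun I _ => I.erase u) (fun I _ => insert u I) ?_ ?_ ?_ ?_ ?_
  · intro I hI
    rw [Finset.mem_filter, mem_indepSets] at hI
    rw [mem_indepSets]
    refine ⟨fun y hy => ?_, fun x hx y hy => hI.1.2 x (Finset.mem_of_mem_erase hx) y
      (Finset.mem_of_mem_erase hy)⟩
    rw [Finset.mem_erase] at hy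
    exact Finset.mem_filter.2 ⟨hI.1.1 hy.2, hI.1.2 u hI.2 y hy.2 hy.1.symm⟩
  · intro I hI
    rw [mem_indepSets] at hI
    rw [Finset.mem_filter, mem_indepSets]
    have hn : ∀ y ∈ I, ¬ R u y := fun y hy => (Finset.mem_filter.1 (hI.1 hy)).2
    refine ⟨⟨Finset.insert_subset hu (hI.1.trans (Finset.filter_subset _ _)), ?_⟩,
      Finset.mem_insert_self _ _⟩
    intro x hx y hy hxy
    rw [Finset.mem_insert] at hx hy
    rcases hx with rfl | hx <;> rcases hy with rfl | hy
    · exact absurd rfl hxy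
    · exact hn y hy
    · exact fun h => hn x hx (hs _ _ h)
    · exact hI.2 x hx y hy hxy
  · intro I hI
    exact Finset.insert_erase (Finset.mem_filter.1 hI).2
  · intro I hI
    refine Finset.erase_insert fun h => ?_
    exact (Finset.mem_filter.1 ((mem_indepSets.1 hI).1 h)).2 (hR u)
  · intro I hI
    exact (Finset.mul_prod_erase I a (Finset.mem_filter.1 hI).2).symm

open Classical in
theorem sizeSum_eq (hR : ∀ x, R x x) (hs : ∀ x y, R x y → R y x) (S : Finset V) :
    sizeSum R a S = ∑ u ∈ S, a u * partitionFn R a (S.filter fun y => ¬ R u y) := by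
  calc sizeSum R a S = ∑ I ∈ indepSets R S, ∑ u ∈ S, if u ∈ I then ∏ v ∈ I, a v else 0 := by
        refine Finset.sum_congr rfl fun I hI => ?_
        rw [← Finset.sum_filter, Finset.sum_const, nsmul_eq_mul, Finset.filter_mem_eq_inter,
          Finset.inter_eq_right.2 (mem_indepSets.1 hI).1]
    _ = ∑ u ∈ S, ∑ I ∈ indepSets R S, if u ∈ I then ∏ v ∈ I, a v else 0 := Finset.sum_comm
    _ = _ := Finset.sum_congr rfl fun u hu => by
        rw [← Finset.sum_filter, sum_indepSets_mem hR hs hu]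

open Classical in
/-- A union bound: the closed neighbourhood of `u` is occupied with probability at most its total
activity. -/
theorem partitionFn_mul_le (ha : ∀ v, 0 ≤ a v) (hR : ∀ x, R x x) (hs : ∀ x y, R x y → R y x)
    (S : Finset V) (u : V) :
    partitionFn R a S * (1 - ∑ y ∈ S with R u y, a y) ≤
      partitionFn R a (S.filter fun y => ¬ R u y) := by
  have hsplit : partitionFn R a S ≤ partitionFn R a (S.filter fun y => ¬ R u y) +
      ∑ y ∈ S with R u y, ∑ I ∈ indepSets R S with y ∈ I, ∏ v ∈ I, a v := by
    simp_rw [Finset.sum_filter (fun I : Finset V => _ ∈ I)]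
    rw [Finset.sum_comm, partitionFn, partitionFn,
      ← Finset.inter_eq_right.2 (indepSets_mono (R := R)
        (Finset.filter_subset (fun y => ¬ R u y) S)), ← Finset.filter_mem_eq_inter,
      Finset.sum_filter, ← Finset.sum_add_distrib]
    refine Finset.sum_le_sum fun I hI => ?_
    have hp : 0 ≤ ∏ v ∈ I, a v := Finset.prod_nonneg fun v _ => ha v
    have hnn : ∀ y ∈ S.filter (fun y => R u y), 0 ≤ if y ∈ I then ∏ v ∈ I, a v else 0 := by
      intro y _; split_ifs <;> simp [hp]
    split_ifs with h
    · linarith [Finset.sum_nonneg hnn]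
    · obtain ⟨y, hy, hyu⟩ : ∃ y ∈ I, R u y := by
        by_contra! hcon
        refine h (mem_indepSets.2 ⟨fun y hy => ?_, (mem_indepSets.1 hI).2⟩)
        exact Finset.mem_filter.2 ⟨(mem_indepSets.1 hI).1 hy, hcon y hy⟩
      have := Finset.single_le_sum hnn
        (Finset.mem_filter.2 ⟨(mem_indepSets.1 hI).1 hy, hyu⟩ : y ∈ S.filter (fun y => R u y))
      rw [if_pos hy] at this
      linarith
  have hle : ∑ y ∈ S with R u y, ∑ I ∈ indepSets R S with y ∈ I, ∏ v ∈ I, a v ≤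
      ∑ y ∈ S with R u y, a y * partitionFn R a S := by
    refine Finset.sum_le_sum fun y hy => ?_
    rw [sum_indepSets_mem hR hs (Finset.mem_filter.1 hy).1]
    exact mul_le_mul_of_nonneg_left (partitionFn_mono ha (Finset.filter_subset _ _)) (ha y)
  rw [← Finset.sum_mul] at hle
  linarith

open Classical in
theorem partitionFn_mul_le_sizeSum (ha : ∀ v, 0 ≤ a v) (hR : ∀ x, R x x)
    (hs : ∀ x y, R x y → R y x) (S : Finset V) :
    partitionFn R a S * (∑ u ∈ S, a u - ∑ u ∈ S, ∑ y ∈ S with R u y, a u * a y) ≤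
      sizeSum R a S := by
  rw [sizeSum_eq hR hs, ← Finset.sum_sub_distrib, Finset.mul_sum]
  refine Finset.sum_le_sum fun u _ => ?_
  have := mul_le_mul_of_nonneg_left (partitionFn_mul_le ha hR hs S u) (ha u)
  rw [← Finset.mul_sum]
  linarith

open Classical in
/-- If `φ` orders the elements of `S` so that every `u` has neighbours of total activity at most `D`
not below it, then the total activity of the ordered pairs of neighbours is at most `2 D a(S)`:
each pair is charged to its lower element. -/
theorem sum_pairs_le (ha : ∀ v, 0 ≤ a v) (hs : ∀ x y, R x y → R y x) {S : Finset V} (φ : V → ℝ)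
    {D : ℝ} (hD : ∀ u ∈ S, ∑ y ∈ S with R u y ∧ φ u ≤ φ y, a y ≤ D) :
    ∑ u ∈ S, ∑ y ∈ S with R u y, a u * a y ≤ 2 * D * ∑ u ∈ S, a u := by
  have h1 : ∑ u ∈ S, ∑ y ∈ S, (if R u y ∧ φ u ≤ φ y then a u * a y else 0) ≤
      D * ∑ u ∈ S, a u := by
    rw [Finset.mul_sum]
    refine Finset.sum_le_sum fun u hu => ?_
    rw [← Finset.sum_filter, ← Finset.mul_sum, mul_comm D]
    exact mul_le_mul_of_nonneg_left (hD u hu) (ha u)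
  have h2 : ∑ u ∈ S, ∑ y ∈ S, (if R y u ∧ φ y ≤ φ u then a y * a u else 0) ≤
      D * ∑ u ∈ S, a u := by
    rw [Finset.sum_comm]; exact h1
  have h3 : ∑ u ∈ S, ∑ y ∈ S with R u y, a u * a y ≤
      ∑ u ∈ S, ∑ y ∈ S, ((if R u y ∧ φ u ≤ φ y then a u * a y else 0) +
        (if R y u ∧ φ y ≤ φ u then a y * a u else 0)) := by
    refine Finset.sum_le_sum fun u _ => ?_
    rw [Finset.sum_filter]
    refine Finset.sum_le_sum fun y _ => ?_
    have hp := mul_nonneg (ha u) (ha y)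
    have hp' := mul_nonneg (ha y) (ha u)
    by_cases hr : R u y
    · have hr' := hs _ _ hr
      rcases le_total (φ u) (φ y) with h | h
      · simp only [hr, hr', h, and_self, if_true, true_and]
        split_ifs <;> linarith
      · simp only [hr, hr', h, and_self, if_true, true_and]
        split_ifs <;> linarith
    · rw [if_neg hr]
      split_ifs <;> linarith
  simp only [Finset.sum_add_distrib] at h3
  linarith

open Classical in
/-- The spatial Markov property: an independent set is a set `J` outside `B` together with an
independent set of the part of `B` that `J` does not block. -/
theorem sum_indepSets_inter [Fintype V] (hs : ∀ x y, R x y → R y x) (B : Finset V)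
    (f : Finset V → ℝ) :
    ∑ I ∈ indepSets R Finset.univ, f (I ∩ B) * ∏ v ∈ I, a v =
      ∑ J ∈ indepSets R Bᶜ, (∏ v ∈ J, a v) *
        ∑ K ∈ indepSets R (B.filter fun x => ∀ y ∈ J, ¬ R x y), f K * ∏ v ∈ K, a v := by
  simp_rw [Finset.mul_sum]
  rw [Finset.sum_sigma']
  have hdisj : ∀ J ∈ indepSets R Bᶜ, ∀ x ∈ J, x ∉ B := fun J hJ x hx =>
    Finset.mem_compl.1 ((mem_indepSets.1 hJ).1 hx)
  refine Finset.sum_bij' (fun I _ => (⟨I \ B, I ∩ B⟩ : (_ : Finset V) × Finset V))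
    (fun p _ => p.1 ∪ p.2) ?_ ?_ ?_ ?_ ?_
  · intro I hI
    have hI' := (mem_indepSets.1 hI).2
    rw [Finset.mem_sigma]
    refine ⟨mem_indepSets.2 ⟨fun x hx => by simpa using (Finset.mem_sdiff.1 hx).2,
      fun x hx y hy => hI' x (Finset.mem_sdiff.1 hx).1 y (Finset.mem_sdiff.1 hy).1⟩,
      mem_indepSets.2 ⟨fun x hx => ?_,
      fun x hx y hy => hI' x (Finset.mem_inter.1 hx).1 y (Finset.mem_inter.1 hy).1⟩⟩
    rw [Finset.mem_inter] at hx
    refine Finset.mem_filter.2 ⟨hx.2, fun y hy => ?_⟩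
    rw [Finset.mem_sdiff] at hy
    exact hI' x hx.1 y hy.1 fun h => hy.2 (h ▸ hx.2)
  · rintro ⟨J, K⟩ hp
    rw [Finset.mem_sigma] at hp
    obtain ⟨hJ, hK⟩ := hp
    have hJK : ∀ x ∈ K, ∀ y ∈ J, ¬ R x y := fun x hx =>
      (Finset.mem_filter.1 ((mem_indepSets.1 hK).1 hx)).2
    refine mem_indepSets.2 ⟨Finset.subset_univ _, fun x hx y hy hxy => ?_⟩
    rcases Finset.mem_union.1 hx with hx | hx <;> rcases Finset.mem_union.1 hy with hy | hy
    · exact (mem_indepSets.1 hJ).2 x hx y hy hxy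
    · exact fun h => hJK y hy x hx (hs _ _ h)
    · exact hJK x hx y hy
    · exact (mem_indepSets.1 hK).2 x hx y hy hxy
  · intro I _
    exact Finset.sdiff_union_inter I B
  · rintro ⟨J, K⟩ hp
    rw [Finset.mem_sigma] at hp
    obtain ⟨hJ, hK⟩ := hp
    have hKB : ∀ x ∈ K, x ∈ B := fun x hx =>
      (Finset.mem_filter.1 ((mem_indepSets.1 hK).1 hx)).1
    have e1 : (J ∪ K) \ B = J := by
      ext x
      have := hdisj J hJ x
      have := hKB x
      simp only [Finset.mem_sdiff, Finset.mem_union]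
      tauto
    have e2 : (J ∪ K) ∩ B = K := by
      ext x
      have := hdisj J hJ x
      have := hKB x
      simp only [Finset.mem_inter, Finset.mem_union]
      tauto
    simp only [e1, e2]
  · intro I _
    have h := Finset.prod_inter_mul_prod_sdiff I B a
    rw [← h]
    ring

open Classical in
/-- The local estimate: in the closed neighbourhood `B` of a vertex, the probability that `B` is
empty and the expected number of occupied vertices of `B` cannot both be small. -/
theorem exp_mul_partitionFn_le [Fintype V] (ha : ∀ v, 0 ≤ a v) (hR : ∀ x, R x x)
    (hs : ∀ x y, R x y → R y x) (B : Finset V) (φ : V → ℝ) {D : ℝ} (hD2 : 2 * D < 1)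
    (hD : ∀ u ∈ B, ∑ y ∈ B with R u y ∧ φ u ≤ φ y, a y ≤ D) (c : ℝ) :
    Real.exp (-c) * (1 + c) * partitionFn R a Finset.univ ≤ partitionFn R a Bᶜ +
      Real.exp (-c) / (1 - 2 * D) *
        ∑ I ∈ indepSets R Finset.univ, ((I ∩ B).card : ℝ) * ∏ v ∈ I, a v := by
  have h1 := sum_indepSets_inter (a := a) hs B fun _ => 1
  have h2 := sum_indepSets_inter (a := a) hs B fun K => (K.card : ℝ)
  simp only [one_mul] at h1
  rw [h2, partitionFn, h1, partitionFn, Finset.mul_sum, Finset.mul_sum, ← Finset.sum_add_distrib]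
  refine Finset.sum_le_sum fun J _ => ?_
  set T := B.filter fun x => ∀ y ∈ J, ¬ R x y with hT
  have hJ : 0 ≤ ∏ v ∈ J, a v := Finset.prod_nonneg fun v _ => ha v
  suffices h : Real.exp (-c) * (1 + c) * partitionFn R a T ≤
      1 + Real.exp (-c) / (1 - 2 * D) * sizeSum R a T by
    have := mul_le_mul_of_nonneg_left h hJ
    rw [partitionFn, sizeSum] at this
    linarith
  set x := ∑ v ∈ T, a v with hx
  have hZ := partitionFn_pos (R := R) ha T
  have hlow : partitionFn R a T * (x * (1 - 2 * D)) ≤ sizeSum R a T := by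
    refine le_trans (mul_le_mul_of_nonneg_left ?_ hZ.le) (partitionFn_mul_le_sizeSum ha hR hs T)
    have := sum_pairs_le (S := T) ha hs φ (D := D) fun u hu => by
      refine le_trans (Finset.sum_le_sum_of_subset_of_nonneg (Finset.filter_subset_filter _
        (Finset.filter_subset _ _)) fun y _ _ => ha y) (hD u (Finset.mem_filter.1 hu).1)
    linarith
  have hM : Real.exp (-c) * (partitionFn R a T * x) ≤
      Real.exp (-c) / (1 - 2 * D) * sizeSum R a T := by
    rw [div_mul_eq_mul_div, le_div_iff₀ (by linarith)]
    have := mul_le_mul_of_nonneg_left hlow (Real.exp_pos (-c)).le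
    linarith
  -- The tangent line of `exp (-x)` at `c` bounds the probability that `T` is empty from below.
  have htan : Real.exp (-c) * (1 + c - x) ≤ Real.exp (-x) := by
    have : Real.exp (-x) = Real.exp (-c) * Real.exp (c - x) := by rw [← Real.exp_add]; ring_nf
    rw [this]
    exact mul_le_mul_of_nonneg_left (by linarith [Real.add_one_le_exp (c - x)]) (Real.exp_pos _).le
  have hone : partitionFn R a T * Real.exp (-x) ≤ 1 := by
    have := mul_le_mul_of_nonneg_right (partitionFn_le_exp (R := R) ha T) (Real.exp_pos (-x)).le
    rwa [← Real.exp_add, add_neg_cancel, Real.exp_zero] at this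
  have := mul_le_mul_of_nonneg_left htan hZ.le
  linarith

open Classical in
/-- A lower bound for the independence number of a weighted graph in which the closed neighbourhood
of every vertex has activity at most `Δ` and spans few edges, obtained as the expected size of a
hard-core random independent set. -/
theorem exists_large_indepSet [Fintype V] (ha : ∀ v, 0 ≤ a v) (hR : ∀ x, R x x)
    (hs : ∀ x y, R x y → R y x) (φ : V → V → ℝ) {Δ D : ℝ} (hD2 : 2 * D < 1)
    (hΔ : ∀ u, ∑ y with R u y, a y ≤ Δ)
    (hD : ∀ v u, R v u → ∑ y with R v y ∧ R u y ∧ φ v u ≤ φ v y, a y ≤ D) (c : ℝ) :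
    ∃ I ∈ indepSets R (Finset.univ : Finset V),
      (1 + c) * ∑ v, a v ≤ I.card * (Real.exp c + Δ / (1 - 2 * D)) := by
  obtain ⟨I, hI, hmax⟩ := Finset.exists_max_image (indepSets R (Finset.univ : Finset V))
    Finset.card ⟨∅, by simp [mem_indepSets]⟩
  refine ⟨I, hI, ?_⟩
  have hZ := partitionFn_pos (R := R) ha Finset.univ
  have hq : 0 < 1 - 2 * D := by linarith
  have hM : sizeSum R a Finset.univ ≤ I.card * partitionFn R a Finset.univ := by
    rw [sizeSum, partitionFn, Finset.mul_sum]
    refine Finset.sum_le_sum fun J hJ => mul_le_mul_of_nonneg_right ?_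
      (Finset.prod_nonneg fun v _ => ha v)
    exact_mod_cast hmax J hJ
  have hloc : ∀ v, Real.exp (-c) * (1 + c) * partitionFn R a Finset.univ ≤
      partitionFn R a (Finset.univ.filter fun y => ¬ R v y) + Real.exp (-c) / (1 - 2 * D) *
        ∑ I ∈ indepSets R Finset.univ,
          ((I ∩ Finset.univ.filter fun y => R v y).card : ℝ) * ∏ v ∈ I, a v := by
    intro v
    have := exp_mul_partitionFn_le ha hR hs (Finset.univ.filter fun y => R v y) (φ v) hD2
      (fun u hu => by
        rw [Finset.filter_filter]
        exact hD v u (Finset.mem_filter.1 hu).2) c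
    rwa [Finset.compl_filter] at this
  have hdeg : ∑ v, a v * ∑ I ∈ indepSets R Finset.univ,
      ((I ∩ Finset.univ.filter fun y => R v y).card : ℝ) * ∏ v ∈ I, a v ≤
      Δ * sizeSum R a Finset.univ := by
    simp_rw [Finset.mul_sum]
    rw [Finset.sum_comm, sizeSum, Finset.mul_sum]
    refine Finset.sum_le_sum fun I _ => ?_
    simp_rw [← mul_assoc]
    rw [← Finset.sum_mul]
    refine mul_le_mul_of_nonneg_right ?_ (Finset.prod_nonneg fun v _ => ha v)
    calc ∑ v, a v * ((I ∩ Finset.univ.filter fun y => R v y).card : ℝ)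
        = ∑ v, ∑ u ∈ I, if R v u then a v else 0 := by
          refine Finset.sum_congr rfl fun v _ => ?_
          rw [← Finset.sum_filter, Finset.sum_const, nsmul_eq_mul, mul_comm,
            Finset.inter_filter, Finset.inter_univ]
      _ = ∑ u ∈ I, ∑ v, if R v u then a v else 0 := Finset.sum_comm
      _ ≤ ∑ u ∈ I, Δ := Finset.sum_le_sum fun u _ => by
          rw [← Finset.sum_filter]
          refine le_trans (le_of_eq (Finset.sum_congr ?_ fun _ _ => rfl)) (hΔ u)
          exact Finset.filter_congr fun v _ => ⟨hs v u, hs u v⟩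
      _ = Δ * I.card := by rw [Finset.sum_const, nsmul_eq_mul, mul_comm]
  have hsum := Finset.sum_le_sum fun v (_ : v ∈ Finset.univ) =>
    mul_le_mul_of_nonneg_left (hloc v) (ha v)
  simp only [mul_add, Finset.sum_add_distrib] at hsum
  rw [← sizeSum_eq hR hs, ← Finset.sum_mul] at hsum
  simp_rw [mul_left_comm (a _) (Real.exp (-c) / (1 - 2 * D))] at hsum
  rw [← Finset.mul_sum] at hsum
  have he : 0 < Real.exp (-c) / (1 - 2 * D) := div_pos (Real.exp_pos _) hq
  have hdeg' := mul_le_mul_of_nonneg_left hdeg he.le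
  have hΔ0 : 0 ≤ Δ ∨ IsEmpty V := by
    rcases isEmpty_or_nonempty V with h | ⟨⟨v⟩⟩
    · exact Or.inr h
    · exact Or.inl ((Finset.sum_nonneg fun y _ => ha y).trans (hΔ v))
  rcases hΔ0 with hΔ0 | hV
  · have hA : 0 ≤ 1 + Real.exp (-c) / (1 - 2 * D) * Δ := by positivity
    have hM' := mul_le_mul_of_nonneg_left hM hA
    have hcomb : Real.exp (-c) * (1 + c) * (∑ v, a v) * partitionFn R a Finset.univ ≤
        (1 + Real.exp (-c) / (1 - 2 * D) * Δ) * I.card * partitionFn R a Finset.univ := by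
      nlinarith
    have h := mul_le_mul_of_nonneg_left (le_of_mul_le_mul_right hcomb hZ) (Real.exp_pos c).le
    have hee : Real.exp c * Real.exp (-c) = 1 := by rw [← Real.exp_add]; simp
    calc (1 + c) * ∑ v, a v = Real.exp c * (Real.exp (-c) * (1 + c) * ∑ v, a v) := by
          rw [← mul_assoc, ← mul_assoc, hee, one_mul]
      _ ≤ _ := h
      _ = I.card * (Real.exp c + (Real.exp c * Real.exp (-c)) * (Δ / (1 - 2 * D))) := by ring
      _ = _ := by rw [hee, one_mul]
  · have hI0 : I = ∅ := Finset.eq_empty_of_isEmpty I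
    simp [hI0]

end HardCore

/-! ### The measure of spherical caps -/

section CapMeasure

open MeasureTheory

/-- An upper bound for the normalised measure of the cap `{x | t ≤ ⟪x, e⟫}` of the unit sphere in
dimension `n + 1`; it is asymptotically sharp for fixed `t`. -/
noncomputable def capBound (n : ℕ) (t : ℝ) : ℝ :=
  √(1 - t ^ 2) ^ n / ((n + 1) * t) * √((n + 2) / (2 * Real.pi))

/-- Log-convexity of the Gamma function on the interval `[x, x + 1]`. -/
theorem Gamma_add_half_le {x : ℝ} (hx : 0 < x) :
    Real.Gamma (x + 1 / 2) ≤ √x * Real.Gamma x := by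
  have h := Real.Gamma_mul_add_mul_le_rpow_Gamma_mul_rpow_Gamma hx (by linarith : 0 < x + 1)
    (a := 1 / 2) (b := 1 / 2) (by norm_num) (by norm_num) (by norm_num)
  have hG := Real.Gamma_pos_of_pos hx
  rw [Real.Gamma_add_one hx.ne', ← Real.sqrt_eq_rpow, ← Real.sqrt_eq_rpow,
    Real.sqrt_mul hx.le] at h
  calc Real.Gamma (x + 1 / 2) = Real.Gamma (1 / 2 * x + 1 / 2 * (x + 1)) := by ring_nf
    _ ≤ _ := h
    _ = √x * (√(Real.Gamma x) * √(Real.Gamma x)) := by ring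
    _ = _ := by rw [Real.mul_self_sqrt hG.le]

/-- In orthonormal coordinates whose first axis is `e`, a Euclidean space of dimension `n + 1` is
`ℝ × ℝⁿ`. -/
theorem exists_isometry_prod {n : ℕ} {e : EuclideanSpace ℝ (Fin (n + 1))} (he : ‖e‖ = 1) :
    ∃ g : EuclideanSpace ℝ (Fin (n + 1)) ≃ₗᵢ[ℝ] WithLp 2 (ℝ × EuclideanSpace ℝ (Fin n)),
      ∀ x, (g x).fst = inner ℝ x e := by
  have hdim : Module.finrank ℝ (WithLp 2 (ℝ × EuclideanSpace ℝ (Fin n))) = n + 1 := by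
    rw [(WithLp.linearEquiv 2 ℝ (ℝ × EuclideanSpace ℝ (Fin n))).finrank_eq]
    simp [add_comm]
  let g₀ : EuclideanSpace ℝ (Fin (n + 1)) ≃ₗᵢ[ℝ] WithLp 2 (ℝ × EuclideanSpace ℝ (Fin n)) :=
    ((stdOrthonormalBasis ℝ (WithLp 2 (ℝ × EuclideanSpace ℝ (Fin n)))).reindex
      (finCongr hdim)).repr.symm
  let e₁ : WithLp 2 (ℝ × EuclideanSpace ℝ (Fin n)) := WithLp.toLp 2 (1, 0)
  have h1 : ‖g₀ e‖ = ‖e₁‖ := by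
    have h : ‖e₁‖ ^ 2 = 1 := by simp [e₁]
    rw [g₀.norm_map, he]
    nlinarith [norm_nonneg e₁]
  let r := Submodule.reflection (Submodule.span ℝ {g₀ e - e₁})ᗮ
  have hr : r (g₀ e) = e₁ := Submodule.reflection_sub h1
  refine ⟨g₀.trans r, fun x => ?_⟩
  have : inner ℝ (r (g₀ x)) (r (g₀ e)) = inner ℝ x e := by
    rw [r.inner_map_map, g₀.inner_map_map]
  rw [← this, hr]
  simp [e₁, WithLp.prod_inner_apply]

theorem integral_mul_one_sub_sq_rpow (n : ℕ) (t : ℝ) :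
    ∫ a in t..1, a * (1 - a ^ 2) ^ ((n : ℝ) / 2) = (1 - t ^ 2) ^ ((n : ℝ) / 2 + 1) / (n + 2) := by
  have hn : (0 : ℝ) ≤ n := n.cast_nonneg
  have hd : ∀ a ∈ Set.uIcc t 1,
      HasDerivAt (fun a : ℝ => -(1 - a ^ 2) ^ ((n : ℝ) / 2 + 1) / (n + 2))
        (a * (1 - a ^ 2) ^ ((n : ℝ) / 2)) a := by
    intro a _
    have h := ((((hasDerivAt_id a).pow 2).const_sub 1).rpow_const (p := (n : ℝ) / 2 + 1)
      (Or.inr (by linarith))).neg.div_const ((n : ℝ) + 2)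
    refine h.congr_deriv ?_
    simp
    field_simp
  rw [intervalIntegral.integral_eq_sub_of_hasDerivAt hd]
  · rw [one_pow, sub_self, Real.zero_rpow (by positivity)]
    ring
  · refine ContinuousOn.intervalIntegrable (continuousOn_id.mul ?_)
    exact ContinuousOn.rpow_const (by fun_prop) fun _ _ => Or.inr (by positivity)

/-- The volume of the sector of the unit ball around `e`: the part below height `t` is a cone, and
above it the slices are balls of radius `√(1 - a ^ 2)`. -/
theorem volume_sector_le {n : ℕ} (hn : 1 ≤ n) {e : EuclideanSpace ℝ (Fin (n + 1))} (he : ‖e‖ = 1)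
    {t : ℝ} (h0 : 0 < t) (h1 : t < 1) :
    volume {x : EuclideanSpace ℝ (Fin (n + 1)) | ‖x‖ ≤ 1 ∧ t * ‖x‖ ≤ inner ℝ x e} ≤
      ENNReal.ofReal (√(1 - t ^ 2) ^ n / ((n + 1) * t)) *
        volume (Metric.closedBall (0 : EuclideanSpace ℝ (Fin n)) 1) := by
  obtain ⟨g, hg⟩ := exists_isometry_prod he
  have hs : 0 < 1 - t ^ 2 := by nlinarith
  set s := √(1 - t ^ 2) with hsdef
  have hs0 : 0 < s := Real.sqrt_pos.2 hs
  have hs2 : s ^ 2 = 1 - t ^ 2 := Real.sq_sqrt hs.le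
  let A : Set (ℝ × EuclideanSpace ℝ (Fin n)) := {p | p.1 ^ 2 + ‖p.2‖ ^ 2 ≤ 1 ∧ 0 ≤ p.1 ∧
    t ^ 2 * (p.1 ^ 2 + ‖p.2‖ ^ 2) ≤ p.1 ^ 2}
  have hA : MeasurableSet A := by
    have c1 : IsClosed {p : ℝ × EuclideanSpace ℝ (Fin n) | p.1 ^ 2 + ‖p.2‖ ^ 2 ≤ 1} :=
      isClosed_le (by fun_prop) (by fun_prop)
    have c2 : IsClosed {p : ℝ × EuclideanSpace ℝ (Fin n) | 0 ≤ p.1} := isClosed_le (by fun_prop) (by fun_prop)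
    have c3 : IsClosed {p : ℝ × EuclideanSpace ℝ (Fin n) | t ^ 2 * (p.1 ^ 2 + ‖p.2‖ ^ 2) ≤ p.1 ^ 2} :=
      isClosed_le (by fun_prop) (by fun_prop)
    exact (c1.inter (c2.inter c3)).measurableSet
  have hmp := (WithLp.volume_preserving_ofLp ℝ (EuclideanSpace ℝ (Fin n))).comp g.measurePreserving
  have hsub : {x : EuclideanSpace ℝ (Fin (n + 1)) | ‖x‖ ≤ 1 ∧ t * ‖x‖ ≤ inner ℝ x e} ⊆
      (WithLp.ofLp ∘ g) ⁻¹' A := by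
    rintro x ⟨hx1, hx2⟩
    have hnorm : ‖x‖ ^ 2 = (g x).fst ^ 2 + ‖(g x).snd‖ ^ 2 := by
      rw [← g.norm_map, WithLp.prod_norm_sq_eq_of_L2, Real.norm_eq_abs, sq_abs]
    rw [← hg] at hx2
    have hx0 : 0 ≤ t * ‖x‖ := by positivity
    refine ⟨?_, hx0.trans hx2, ?_⟩
    · change (g x).fst ^ 2 + ‖(g x).snd‖ ^ 2 ≤ 1
      rw [← hnorm]
      exact pow_le_one₀ (norm_nonneg _) hx1
    · change t ^ 2 * ((g x).fst ^ 2 + ‖(g x).snd‖ ^ 2) ≤ (g x).fst ^ 2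
      rw [← hnorm, ← mul_pow]
      exact pow_le_pow_left₀ hx0 hx2 2
  set ω := volume (Metric.closedBall (0 : EuclideanSpace ℝ (Fin n)) 1) with hω
  have hball : ∀ r : ℝ, 0 ≤ r → volume (Metric.closedBall (0 : EuclideanSpace ℝ (Fin n)) r) =
      ENNReal.ofReal (r ^ n) * ω := by
    intro r hr
    rw [Measure.addHaar_closedBall' _ _ hr]
    rw [finrank_euclideanSpace_fin]
  let f : ℝ → ENNReal := fun a =>
    (Set.Icc 0 t).indicator (fun a => ENNReal.ofReal ((s / t * a) ^ n)) a +
    (Set.Icc t 1).indicator (fun a => ENNReal.ofReal (1 / t * (a * (1 - a ^ 2) ^ ((n : ℝ) / 2)))) a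
  have hslice : ∀ a : ℝ, volume (Prod.mk a ⁻¹' A) ≤ f a * ω := by
    intro a
    by_cases ha : 0 ≤ a ∧ a ≤ 1
    · rcases le_total a t with hat | hat
      · have hsub : Prod.mk a ⁻¹' A ⊆ Metric.closedBall (0 : EuclideanSpace ℝ (Fin n)) (s / t * a) := by
          rintro y ⟨-, -, hy⟩
          rw [mem_closedBall_zero_iff]
          refine le_of_sq_le_sq ?_ (by have := ha.1; positivity)
          rw [mul_pow, div_pow, hs2, div_mul_eq_mul_div, le_div_iff₀ (by positivity)]
          linarith
        refine (measure_mono hsub).trans ?_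
        rw [hball _ (mul_nonneg (by positivity) ha.1)]
        refine mul_le_mul_left ?_ _
        simp only [f]
        have hmem : a ∈ Set.Icc 0 t := ⟨ha.1, hat⟩
        rw [Set.indicator_of_mem hmem]
        exact le_self_add
      · have ha2 : 0 ≤ 1 - a ^ 2 := by nlinarith [ha.1, ha.2]
        have hsub : Prod.mk a ⁻¹' A ⊆ Metric.closedBall (0 : EuclideanSpace ℝ (Fin n)) √(1 - a ^ 2) := by
          rintro y ⟨hy, -, -⟩
          rw [mem_closedBall_zero_iff]
          refine Real.le_sqrt_of_sq_le ?_
          simp only at hy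
          linarith
        refine (measure_mono hsub).trans ?_
        rw [hball _ (Real.sqrt_nonneg _)]
        refine mul_le_mul_left ?_ _
        simp only [f]
        have hmem : a ∈ Set.Icc t 1 := ⟨hat, ha.2⟩
        rw [Set.indicator_of_mem hmem]
        refine le_trans (ENNReal.ofReal_le_ofReal ?_) le_add_self
        rw [Real.sqrt_eq_rpow, ← Real.rpow_mul_natCast ha2, ← mul_assoc,
          show (1 : ℝ) / 2 * n = n / 2 by ring]
        refine le_mul_of_one_le_left (Real.rpow_nonneg ha2 _) ?_
        rw [one_div_mul_eq_div, le_div_iff₀ h0]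
        linarith
    · have : Prod.mk a ⁻¹' A = ∅ := by
        refine Set.eq_empty_iff_forall_notMem.2 ?_
        rintro y ⟨hy, hy0, -⟩
        simp only at hy hy0
        exact ha ⟨hy0, by nlinarith [sq_nonneg ‖y‖]⟩
      simp [this]
  have hi1 : ∫⁻ a in Set.Icc 0 t, ENNReal.ofReal ((s / t * a) ^ n) =
      ENNReal.ofReal (t * s ^ n / (n + 1)) := by
    rw [← ofReal_integral_eq_lintegral_ofReal, integral_Icc_eq_integral_Ioc,
      ← intervalIntegral.integral_of_le h0.le]
    · simp_rw [mul_pow]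
      rw [intervalIntegral.integral_const_mul, integral_pow]
      congr 1
      simp
      rw [div_pow, pow_succ]
      field_simp
    · exact (Continuous.integrableOn_Icc (by fun_prop))
    · refine (ae_restrict_iff' measurableSet_Icc).2 (ae_of_all _ fun a ha => ?_)
      exact pow_nonneg (mul_nonneg (by positivity) ha.1) _
  have hi2 : ∫⁻ a in Set.Icc t 1,
      ENNReal.ofReal (1 / t * (a * (1 - a ^ 2) ^ ((n : ℝ) / 2))) =
      ENNReal.ofReal (1 / t * ((1 - t ^ 2) ^ ((n : ℝ) / 2 + 1) / (n + 2))) := by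
    rw [← ofReal_integral_eq_lintegral_ofReal, integral_Icc_eq_integral_Ioc,
      ← intervalIntegral.integral_of_le h1.le, intervalIntegral.integral_const_mul,
      integral_mul_one_sub_sq_rpow n t]
    · refine ContinuousOn.integrableOn_Icc (continuousOn_const.mul (continuousOn_id.mul ?_))
      exact ContinuousOn.rpow_const (by fun_prop) fun _ _ => Or.inr (by positivity)
    · refine (ae_restrict_iff' measurableSet_Icc).2 (ae_of_all _ fun a ha => ?_)
      have ha0 : 0 ≤ a := h0.le.trans ha.1
      have : 0 ≤ 1 - a ^ 2 := by nlinarith [ha.2]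
      exact mul_nonneg (by positivity) (mul_nonneg ha0 (Real.rpow_nonneg this _))
  have hsn : (1 - t ^ 2) ^ ((n : ℝ) / 2 + 1) = s ^ n * (1 - t ^ 2) := by
    rw [Real.rpow_add_one hs.ne', hsdef, Real.sqrt_eq_rpow, ← Real.rpow_mul_natCast hs.le]
    ring_nf
  calc volume {x : EuclideanSpace ℝ (Fin (n + 1)) | ‖x‖ ≤ 1 ∧ t * ‖x‖ ≤ inner ℝ x e}
      ≤ volume ((WithLp.ofLp ∘ g) ⁻¹' A) := measure_mono hsub
    _ = volume A := hmp.measure_preimage hA.nullMeasurableSet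
    _ = ∫⁻ a, volume (Prod.mk a ⁻¹' A) := by
        rw [Measure.volume_eq_prod, Measure.prod_apply hA]
    _ ≤ ∫⁻ a, f a * ω := lintegral_mono hslice
    _ = (∫⁻ a, f a) * ω := lintegral_mul_const' _ _ (by
        rw [hω]; exact (isCompact_closedBall _ _).measure_lt_top.ne)
    _ ≤ _ := by
        refine mul_le_mul_left ?_ _
        simp only [f]
        rw [lintegral_add_left, lintegral_indicator measurableSet_Icc,
          lintegral_indicator measurableSet_Icc, hi1, hi2, hsn, ← ENNReal.ofReal_add]
        · refine ENNReal.ofReal_le_ofReal ?_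
          have hle : 1 / t * (s ^ n * (1 - t ^ 2) / (n + 2)) ≤
              1 / t * (s ^ n * (1 - t ^ 2) / (n + 1)) := by
            gcongr
            norm_num
          refine (add_le_add_right hle _).trans (le_of_eq ?_)
          field_simp
          ring
        · positivity
        · have := hs.le
          positivity
        · exact Measurable.indicator (by fun_prop) measurableSet_Icc

theorem volume_closedBall_le {n : ℕ} (hn : 1 ≤ n) :
    volume (Metric.closedBall (0 : EuclideanSpace ℝ (Fin n)) 1) ≤
      ENNReal.ofReal √((n + 2) / (2 * Real.pi)) *
        volume (Metric.closedBall (0 : EuclideanSpace ℝ (Fin (n + 1))) 1) := by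
  have : Nonempty (Fin n) := ⟨⟨0, hn⟩⟩
  rw [EuclideanSpace.volume_closedBall, EuclideanSpace.volume_closedBall]
  simp only [ENNReal.ofReal_one, one_pow, one_mul, Fintype.card_fin]
  rw [← ENNReal.ofReal_mul (by positivity)]
  refine ENNReal.ofReal_le_ofReal ?_
  have hx : (0 : ℝ) < n / 2 + 1 := by positivity
  have hG := Gamma_add_half_le hx
  have h1 := Real.Gamma_pos_of_pos hx
  have h2 := Real.Gamma_pos_of_pos (by linarith : (0 : ℝ) < n / 2 + 1 + 1 / 2)
  have hpi : 0 < √Real.pi := Real.sqrt_pos.2 Real.pi_pos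
  have e1 : ((n + 1 : ℕ) : ℝ) / 2 + 1 = n / 2 + 1 + 1 / 2 := by push_cast; ring
  have e2 : √(((n : ℝ) + 2) / (2 * Real.pi)) = √((n : ℝ) / 2 + 1) / √Real.pi := by
    rw [← Real.sqrt_div hx.le]
    congr 1
    field_simp
  rw [e1, e2, div_mul_div_comm, div_le_div_iff₀ h1 (by positivity), pow_succ]
  have := mul_le_mul_of_nonneg_left hG (by positivity : 0 ≤ √Real.pi ^ n * √Real.pi)
  linarith

theorem measureReal_sector_le {n : ℕ} (hn : 1 ≤ n) {e : EuclideanSpace ℝ (Fin (n + 1))}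
    (he : ‖e‖ = 1) {t : ℝ} (h0 : 0 < t) (h1 : t < 1) :
    volume.real {x : EuclideanSpace ℝ (Fin (n + 1)) | ‖x‖ ≤ 1 ∧ t * ‖x‖ ≤ inner ℝ x e} ≤
      capBound n t * volume.real (Metric.closedBall (0 : EuclideanSpace ℝ (Fin (n + 1))) 1) := by
  have h := (volume_sector_le hn he h0 h1).trans
    (mul_le_mul_right (volume_closedBall_le hn) _)
  rw [← mul_assoc, ← ENNReal.ofReal_mul (by positivity)] at h
  have hfin : volume (Metric.closedBall (0 : EuclideanSpace ℝ (Fin (n + 1))) 1) ≠ ⊤ :=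
    (isCompact_closedBall _ _).measure_lt_top.ne
  have := ENNReal.toReal_mono (ENNReal.mul_ne_top ENNReal.ofReal_ne_top hfin) h
  rw [ENNReal.toReal_mul, ENNReal.toReal_ofReal (by positivity)] at this
  exact this

end CapMeasure

/-! ### From the sphere to a weighted finite graph -/

section Net

open MeasureTheory

/-- A finite net of the unit sphere in dimension `n + 1`, each point weighted by the normalised
measure of a cell of directions close to it. The weights inherit the cap bound, with a loss of `δ`
in the height of the cap. -/
theorem exists_weighted_net {n : ℕ} (hn : 1 ≤ n) {δ : ℝ} (hδ : 0 < δ) :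
    ∃ (m : ℕ) (c : Fin m → EuclideanSpace ℝ (Fin (n + 1))) (w : Fin m → ℝ),
      (∀ i, ‖c i‖ = 1) ∧ (∀ i, 0 ≤ w i) ∧ ∑ i, w i = 1 ∧
      ∀ (S : Finset (Fin m)) (e : EuclideanSpace ℝ (Fin (n + 1))) (t : ℝ), ‖e‖ = 1 → 0 < t →
        t < 1 → (∀ i ∈ S, t + δ ≤ inner ℝ (c i) e) → ∑ i ∈ S, w i ≤ capBound n t := by
  obtain ⟨s, hs, hsfin, hcov⟩ := (isCompact_sphere
    (0 : EuclideanSpace ℝ (Fin (n + 1))) 1).finite_cover_balls hδ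
  obtain ⟨m, c, hc⟩ := hsfin.fin_param
  have hcs : ∀ i, ‖c i‖ = 1 := fun i => by
    simpa using hs (hc.2 ▸ Set.mem_range_self i)
  let A : Fin m → Set (EuclideanSpace ℝ (Fin (n + 1))) := fun i =>
    {x | ‖x - ‖x‖ • c i‖ ≤ δ * ‖x‖}
  have hA : ∀ i, MeasurableSet (A i) := fun i =>
    (isClosed_le (by fun_prop) (by fun_prop)).measurableSet
  have hAcov : ∀ x, ∃ i, x ∈ A i := by
    intro x
    obtain ⟨y, hy1, hxy⟩ : ∃ y : EuclideanSpace ℝ (Fin (n + 1)), ‖y‖ = 1 ∧ x = ‖x‖ • y := by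
      rcases eq_or_ne x 0 with rfl | hx
      · exact ⟨EuclideanSpace.single 0 1, by simp, by simp⟩
      · refine ⟨‖x‖⁻¹ • x, norm_smul_inv_norm hx, ?_⟩
        rw [smul_smul, mul_inv_cancel₀ (norm_ne_zero_iff.2 hx), one_smul]
    have hy := hcov (show y ∈ Metric.sphere 0 1 by simpa using hy1)
    simp only [Set.mem_iUnion, Metric.mem_ball] at hy
    obtain ⟨p, hp, hyp⟩ := hy
    rw [← hc.2] at hp
    obtain ⟨i, rfl⟩ := hp
    refine ⟨i, ?_⟩
    change ‖x - ‖x‖ • c i‖ ≤ δ * ‖x‖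
    nth_rewrite 1 [hxy]
    rw [← smul_sub, norm_smul, norm_norm, mul_comm]
    rw [dist_eq_norm] at hyp
    exact mul_le_mul_of_nonneg_right hyp.le (norm_nonneg _)
  obtain ⟨B, hBA, hBsup, hBm, hBd⟩ : ∃ B : Fin m → Set (EuclideanSpace ℝ (Fin (n + 1))),
      (∀ i, B i ⊆ A i) ∧ (⋃ i, B i) = Set.univ ∧ (∀ i, MeasurableSet (B i)) ∧
      Pairwise (Function.onFun Disjoint B) := by
    refine ⟨disjointed A, disjointed_le A, ?_, fun i => ?_, disjoint_disjointed A⟩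
    · have := iSup_disjointed A
      simp only [Set.iSup_eq_iUnion] at this
      rw [this]
      exact Set.eq_univ_of_forall fun x => Set.mem_iUnion.2 (hAcov x)
    · exact disjointedRec (p := MeasurableSet) (fun t i ht => ht.diff (hA i)) (hA i)
  set U := Metric.closedBall (0 : EuclideanSpace ℝ (Fin (n + 1))) 1 with hU
  have hUfin : volume U ≠ ⊤ := (isCompact_closedBall _ _).measure_lt_top.ne
  have hUpos : 0 < volume.real U :=
    ENNReal.toReal_pos (Metric.measure_closedBall_pos volume _ one_pos).ne' hUfin
  have hsum : ∀ S : Finset (Fin m), ∑ i ∈ S, volume.real (B i ∩ U) =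
      volume.real (⋃ i ∈ S, B i ∩ U) := fun S => by
    rw [measureReal_biUnion_finset]
    · exact fun i _ j _ hij => (hBd hij).mono Set.inter_subset_left Set.inter_subset_left
    · exact fun i _ => (hBm i).inter Metric.isClosed_closedBall.measurableSet
  refine ⟨m, c, fun i => volume.real (B i ∩ U) / volume.real U, hcs, fun i => by positivity, ?_, ?_⟩
  · rw [← Finset.sum_div, hsum]
    simp only [Finset.mem_univ, Set.iUnion_true]
    rw [← Set.iUnion_inter, hBsup, Set.univ_inter, div_self hUpos.ne']
  · intro S e t he h0 h1 hS
    rw [← Finset.sum_div, hsum, div_le_iff₀ hUpos]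
    refine le_trans (measureReal_mono ?_ ?_) (measureReal_sector_le hn he h0 h1)
    · intro x hx
      simp only [Set.mem_iUnion] at hx
      obtain ⟨i, hi, hxB, hxU⟩ := hx
      have hx1 : ‖x - ‖x‖ • c i‖ ≤ δ * ‖x‖ := hBA i hxB
      refine ⟨by simpa [hU] using hxU, ?_⟩
      have h2 := real_inner_le_norm (‖x‖ • c i - x) e
      rw [he, mul_one, norm_sub_rev, inner_sub_left, real_inner_smul_left] at h2
      have h3 := mul_le_mul_of_nonneg_left (hS i hi) (norm_nonneg x)
      linarith
    · exact measure_ne_top_of_subset (fun x hx => by simpa [hU] using hx.1) hUfin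

/-- Two caps of angular radius `π / 3` with centres `u` and `v`, the second one cut down to the
height `⟪u, v⟫` of `u`, meet inside a cap of height `1 / √3` around the midpoint of `u` and `v`. -/
theorem exists_cap_of_inter {E : Type*} [NormedAddCommGroup E] [InnerProductSpace ℝ E] {u v : E}
    (hu : ‖u‖ = 1) (hv : ‖v‖ = 1) (huv : 1 / 2 ≤ inner ℝ v u) :
    ∃ e : E, ‖e‖ = 1 ∧ ∀ y, 1 / 2 ≤ inner ℝ u y → inner ℝ v u ≤ inner ℝ v y →
      1 / √3 ≤ inner ℝ y e := by
  set τ : ℝ := inner ℝ v u with hτ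
  have hn : ‖v + u‖ ^ 2 = 2 + 2 * τ := by
    rw [norm_add_sq_real, hu, hv]; ring
  have hpos : 0 < ‖v + u‖ := by
    refine lt_of_le_of_ne (norm_nonneg _) fun h => ?_
    rw [← h] at hn
    linarith
  refine ⟨‖v + u‖⁻¹ • (v + u), norm_smul_inv_norm (norm_pos_iff.1 hpos), fun y h1 h2 => ?_⟩
  rw [real_inner_smul_right, inner_add_right, real_inner_comm, real_inner_comm u y,
    inv_mul_eq_div, div_le_div_iff₀ (by positivity) hpos, one_mul]
  have h3 : 0 < √3 := by positivity
  have h4 : √3 ^ 2 = 3 := Real.sq_sqrt (by norm_num)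
  have h5 : ‖v + u‖ ≤ (τ + 1 / 2) * √3 := by
    refine le_of_sq_le_sq ?_ (by positivity)
    rw [hn, mul_pow, h4]
    nlinarith
  refine h5.trans (mul_le_mul_of_nonneg_right ?_ h3.le)
  linarith

theorem continuousAt_capBound (n : ℕ) {t : ℝ} (ht : 0 < t) : ContinuousAt (capBound n) t := by
  unfold capBound
  have : ((n : ℝ) + 1) * t ≠ 0 := by positivity
  fun_prop (disch := assumption)

/-- The hard-core lower bound on the sphere: `Δ` bounds the measure of a cap of angular radius
`π / 3`, `D` that of the intersections of two such caps, and `l` is the fugacity. -/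
theorem le_maxSphericalCode {n : ℕ} (hn : 1 ≤ n) {Δ D l : ℝ} (hΔ : capBound n (1 / 2) < Δ)
    (hD : capBound n (1 / √3) < D) (hl : 0 < l) (hlD : 2 * (l * D) < 1) (c : ℝ) :
    (1 + c) * l ≤ maxSphericalCode (n + 1) (Real.pi / 3) *
      (Real.exp c + l * Δ / (1 - 2 * (l * D))) := by
  have h3 : (1 : ℝ) < √3 := by
    rw [Real.lt_sqrt (by norm_num)]; norm_num
  have hcont : ∀ t : ℝ, 0 < t → Tendsto (fun δ : ℝ => capBound n (t - δ)) (𝓝[>] 0)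
      (𝓝 (capBound n t)) := by
    intro t ht
    have h : Tendsto (fun δ : ℝ => t - δ) (𝓝[>] 0) (𝓝 t) := by
      refine tendsto_nhdsWithin_of_tendsto_nhds ?_
      simpa using (tendsto_const_nhds (x := t)).sub (tendsto_id (α := ℝ) (x := 𝓝 0))
    exact (continuousAt_capBound n ht).tendsto.comp h
  have e1 := (hcont (1 / 2) (by norm_num)).eventually_lt_const hΔ
  have e2 := (hcont (1 / √3) (by positivity)).eventually_lt_const hD
  have e3 : ∀ᶠ δ : ℝ in 𝓝[>] 0, δ < min (1 / 2) (1 / √3) :=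
    eventually_nhdsWithin_of_eventually_nhds (eventually_lt_nhds (by positivity))
  obtain ⟨δ, hδ1, hδ2, hδ3, hδ⟩ := (e1.and (e2.and (e3.and self_mem_nhdsWithin))).exists
  have hδ0 : 0 < δ := hδ
  obtain ⟨hδ4, hδ5⟩ := lt_min_iff.1 hδ3
  have h31 : 1 / √3 < 1 := by rw [div_lt_one (by positivity)]; exact h3
  obtain ⟨m, p, w, hp, hw, hw1, hcap⟩ := exists_weighted_net hn hδ0
  obtain ⟨I, hI, hbound⟩ := exists_large_indepSet (V := Fin m) (a := fun i => l * w i)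
    (R := fun i j => 1 / 2 < inner ℝ (p i) (p j)) (Δ := l * Δ) (D := l * D)
    (fun i => mul_nonneg hl.le (hw i))
    (fun i => by rw [real_inner_self_eq_norm_sq, hp]; norm_num)
    (fun i j h => by rwa [real_inner_comm]) (fun i j => inner ℝ (p i) (p j)) hlD
    (fun i => by
      rw [← Finset.mul_sum]
      refine mul_le_mul_of_nonneg_left (le_trans (hcap _ (p i) (1 / 2 - δ) (hp i) (by linarith)
        (by linarith) fun j hj => ?_) hδ1.le) hl.le
      have := (Finset.mem_filter.1 hj).2
      rw [real_inner_comm] at this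
      linarith)
    (fun v u hvu => by
      rw [← Finset.mul_sum]
      obtain ⟨e, he, hey⟩ := exists_cap_of_inter (hp u) (hp v) hvu.le
      refine mul_le_mul_of_nonneg_left (le_trans (hcap _ e (1 / √3 - δ) he (by linarith)
        (by linarith) fun j hj => ?_) hδ2.le) hl.le
      have := (Finset.mem_filter.1 hj).2
      linarith [hey (p j) this.2.1.le this.2.2]) c
  rw [← Finset.mul_sum, hw1, mul_one] at hbound
  refine hbound.trans (mul_le_mul_of_nonneg_right ?_ ?_)
  · have hind := (mem_indepSets.1 hI).2
    have hinj : Set.InjOn p I := by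
      intro x hx y hy hxy
      by_contra hne
      refine hind x hx y hy hne ?_
      rw [hxy, real_inner_self_eq_norm_sq, hp]
      norm_num
    have := (isGreatest_maxSphericalCode (n + 1) (θ := Real.pi / 3) (by positivity)
      (by linarith [Real.pi_pos])).2 ⟨I.image p, ⟨?_, ?_⟩, rfl⟩
    · rw [Finset.card_image_of_injOn hinj] at this
      exact_mod_cast this
    · intro x hx
      obtain ⟨i, _, rfl⟩ := Finset.mem_image.1 hx
      simpa using hp i
    · intro x hx y hy hxy
      obtain ⟨i, hi, rfl⟩ := Finset.mem_image.1 hx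
      obtain ⟨j, hj, rfl⟩ := Finset.mem_image.1 hy
      rw [Real.cos_pi_div_three]
      exact not_lt.1 (hind i hi j hj fun h => hxy (h ▸ rfl))
  · have hΔ0 : 0 ≤ Δ := by
      refine le_trans ?_ hΔ.le
      unfold capBound
      positivity
    have : 0 < 1 - 2 * (l * D) := by linarith
    positivity

end Net

/-! ### Asymptotics in the dimension -/

section Asymptotics

open Real

/-- The exponent `c` for which `e ^ c` is the fugacity times the measure of a cap of angular radius
`π / 3`, divided by the dimension `x`. -/
noncomputable def capExponent (x : ℝ) : ℝ :=
  (x - 1) * log (3 / (2 * √2)) - log √3 - 2 * log x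

/-- The ratio between the hard-core lower bound in dimension `x` and its leading term. -/
noncomputable def boundRatio (x : ℝ) : ℝ :=
  (1 + capExponent x) / (log (3 / (2 * √2)) * x) * √(x / (x + 1)) /
    ((1 + 1 / x) * (1 / x + 1 / (1 - 1 / x)))

theorem sqrt_two_lt : 2 * √2 < 3 := by
  nlinarith [Real.sq_sqrt (show (0 : ℝ) ≤ 2 by norm_num), Real.sqrt_nonneg 2]

theorem log_const_pos : 0 < log (3 / (2 * √2)) :=
  log_pos ((one_lt_div (by positivity)).2 sqrt_two_lt)

theorem tendsto_boundRatio : Tendsto boundRatio atTop (𝓝 1) := by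
  have hL := log_const_pos
  set L := log (3 / (2 * √2)) with hLdef
  have hinv : Tendsto (fun x : ℝ => 1 / x) atTop (𝓝 0) := by
    simpa using tendsto_inv_atTop_zero (𝕜 := ℝ)
  have hlog : Tendsto (fun x : ℝ => log x / x) atTop (𝓝 0) :=
    isLittleO_log_id_atTop.tendsto_div_nhds_zero
  have h1 : Tendsto (fun x : ℝ => (1 + capExponent x) / (L * x)) atTop (𝓝 1) := by
    have h : Tendsto (fun x : ℝ => 1 + (1 - L - log √3) / L * (1 / x) - 2 / L * (log x / x)) atTop
        (𝓝 (1 + (1 - L - log √3) / L * 0 - 2 / L * 0)) :=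
      ((hinv.const_mul _).const_add 1).sub (hlog.const_mul _)
    simp only [mul_zero, add_zero, sub_zero] at h
    refine h.congr' ?_
    filter_upwards [eventually_gt_atTop 0] with x hx
    rw [capExponent, ← hLdef]
    field_simp
    ring
  have h2 : Tendsto (fun x : ℝ => √(x / (x + 1))) atTop (𝓝 1) := by
    have h : Tendsto (fun x : ℝ => √(1 / (1 + 1 / x))) atTop (𝓝 √(1 / (1 + 0))) :=
      (tendsto_const_nhds.div (hinv.const_add 1) (by norm_num)).sqrt
    simp only [add_zero, div_one, sqrt_one] at h
    refine h.congr' ?_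
    filter_upwards [eventually_gt_atTop 0] with x hx
    congr 1
    field_simp
  have h3 : Tendsto (fun x : ℝ => (1 + 1 / x) * (1 / x + 1 / (1 - 1 / x))) atTop
      (𝓝 ((1 + 0) * (0 + 1 / (1 - 0)))) :=
    (hinv.const_add 1).mul (hinv.add (tendsto_const_nhds.div (hinv.const_sub 1) (by norm_num)))
  have h := (h1.mul h2).div h3 (by norm_num)
  rwa [show (1 * 1 / ((1 + 0) * (0 + 1 / (1 - 0))) : ℝ) = 1 by norm_num] at h

theorem capBound_half (n : ℕ) :
    capBound n (1 / 2) = (√3 / 2) ^ n * 2 / (n + 1) * √((n + 2) / (2 * π)) := by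
  have h : √(1 - (1 / 2) ^ 2 : ℝ) = √3 / 2 := by
    rw [show (1 - (1 / 2) ^ 2 : ℝ) = 3 / 2 ^ 2 by norm_num, sqrt_div (by norm_num),
      sqrt_sq (by norm_num)]
  rw [capBound, h]
  field_simp

theorem capBound_inv_sqrt_three (n : ℕ) :
    capBound n (1 / √3) = (√2 / √3) ^ n * √3 / (n + 1) * √((n + 2) / (2 * π)) := by
  have h : √(1 - (1 / √3) ^ 2 : ℝ) = √2 / √3 := by
    rw [div_pow, sq_sqrt (by norm_num), ← sqrt_div (by norm_num)]
    norm_num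
  rw [capBound, h]
  field_simp

theorem exp_capExponent (n : ℕ) :
    exp (capExponent (n + 1)) * ((n + 1) ^ 2 * 2 * capBound n (1 / √3)) = capBound n (1 / 2) := by
  have hpos : (0 : ℝ) < n + 1 := by positivity
  have h3 : (√3) ^ 2 = 3 := sq_sqrt (by norm_num)
  have hexp : exp (capExponent (n + 1)) = (3 / (2 * √2)) ^ n / √3 / (n + 1) ^ 2 := by
    rw [capExponent, exp_sub, exp_sub, exp_log (by positivity), add_sub_cancel_right,
      exp_nat_mul, exp_log (by positivity), ← log_rpow hpos, exp_log (by positivity)]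
    norm_num
  have hmul : (√3 / 2) ^ n = (3 / (2 * √2)) ^ n * (√2 / √3) ^ n := by
    rw [← mul_pow]
    congr 1
    field_simp
    linarith
  rw [hexp, capBound_half, capBound_inv_sqrt_three, hmul]
  field_simp

/-- The leading term of the bound, written through the measure of the cap of angular radius
`π / 3`. -/
theorem leading_term_mul_capBound (n : ℕ) :
    √(3 * π / 8) * ((n + 1 : ℕ) : ℝ) ^ (3 / 2 : ℝ) * (2 / √3) ^ (n + 1) *
      √((n + 1) / (n + 1 + 1)) * capBound n (1 / 2) = n + 1 := by
  have hpos : (0 : ℝ) < n + 1 := by positivity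
  have hx : ((n + 1 : ℕ) : ℝ) ^ (3 / 2 : ℝ) = (n + 1) * √(n + 1) := by
    rw [Nat.cast_add_one, show (3 / 2 : ℝ) = 1 + 1 / 2 by norm_num, rpow_add hpos, rpow_one,
      sqrt_eq_rpow]
  have hp : (2 / √3) ^ (n + 1) * (√3 / 2) ^ n = 2 / √3 := by
    rw [pow_succ, mul_right_comm, ← mul_pow, div_mul_div_comm, mul_comm 2, div_self (by positivity),
      one_pow, one_mul]
  have hq : √(3 * π / 8) * √((n + 1) / (n + 1 + 1)) * √((n + 2) / (2 * π)) * √(n + 1) =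
      √3 / 4 * (n + 1) := by
    rw [← sqrt_mul (by positivity), ← sqrt_mul (by positivity), ← sqrt_mul (by positivity),
      show 3 * π / 8 * (((n : ℝ) + 1) / (n + 1 + 1)) * ((n + 2) / (2 * π)) * (n + 1) =
        3 * ((n + 1) / 4) ^ 2 by field_simp; ring, sqrt_mul (by norm_num), sqrt_sq (by positivity)]
    ring
  rw [hx, capBound_half]
  calc _ = (√(3 * π / 8) * √((n + 1) / (n + 1 + 1)) * √((n + 2) / (2 * π)) * √(n + 1)) *
        ((2 / √3) ^ (n + 1) * (√3 / 2) ^ n) * 2 * ((n + 1) / (n + 1)) := by ring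
    _ = _ := by
      rw [hq, hp]
      field_simp
      norm_num

theorem boundRatio_mul_le {d : ℕ} (hd : 2 ≤ d) :
    boundRatio d * (√(3 * π / 8) * log (3 / (2 * √2)) * (d : ℝ) ^ (3 / 2 : ℝ) * (2 / √3) ^ d) ≤
      maxSphericalCode d (π / 3) := by
  obtain ⟨n, rfl⟩ : ∃ n, d = n + 1 := ⟨d - 1, by omega⟩
  have hn : 1 ≤ n := by omega
  have hn' : (1 : ℝ) ≤ n := by exact_mod_cast hn
  have hL := log_const_pos
  set L := log (3 / (2 * √2)) with hLdef
  have hS : 0 < capBound n (1 / 2) := by rw [capBound_half]; positivity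
  have hT : 0 < capBound n (1 / √3) := by rw [capBound_inv_sqrt_three]; positivity
  have hexp := exp_capExponent n
  have hlead := leading_term_mul_capBound n
  have hcast : ((n + 1 : ℕ) : ℝ) = n + 1 := by push_cast; ring
  rw [boundRatio, ← hLdef, hcast]
  rw [hcast] at hlead
  set S := capBound n (1 / 2) with hSdef
  set T := capBound n (1 / √3) with hTdef
  set x : ℝ := n + 1 with hx
  have hx1 : 1 < x := by linarith
  have hx0 : 0 < x := by linarith
  have hy : 0 < 1 - 1 / x := by rw [sub_pos, div_lt_one hx0]; exact hx1
  have hy1 : 1 < 1 + 1 / x := by have : 0 < 1 / x := by positivity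
                                 linarith
  -- With this fugacity the correction `1 - 2 * (l * D)` is `1 - 1 / x`.
  set l := 1 / (2 * x * ((1 + 1 / x) * T)) with hl
  have hl0 : 0 < l := by positivity
  have hlD : 2 * (l * ((1 + 1 / x) * T)) = 1 / x := by
    rw [hl]; field_simp
  have hmain := le_maxSphericalCode hn (Δ := (1 + 1 / x) * S) (D := (1 + 1 / x) * T) (l := l)
    (lt_mul_of_one_lt_left hS hy1) (lt_mul_of_one_lt_left hT hy1) hl0 (by rw [hlD]; linarith)
    (capExponent x)
  rw [hlD] at hmain
  have hec : exp (capExponent x) = l * ((1 + 1 / x) * S) * (1 / x) := by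
    rw [hl, ← hexp]
    field_simp
  rw [hec] at hmain
  set κ := (1 + 1 / x) * (1 / x + 1 / (1 - 1 / x)) with hκ
  have hκ0 : 0 < κ := by positivity
  set K : ℝ := (maxSphericalCode (n + 1) (π / 3) : ℝ)
  have hmain' : 1 + capExponent x ≤ K * (S * κ) := by
    refine le_of_mul_le_mul_right (hmain.trans (le_of_eq ?_)) hl0
    rw [hκ]
    ring
  refine le_of_mul_le_mul_right (le_trans (le_of_eq ?_) hmain') (mul_pos hS hκ0)
  calc _ = (1 + capExponent x) * (L / L) * (κ / κ) * ((√(3 * π / 8) * x ^ (3 / 2 : ℝ) *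
        (2 / √3) ^ (n + 1) * √(x / (x + 1)) * S) / x) := by
        field_simp
    _ = _ := by rw [hlead, div_self hL.ne', div_self hκ0.ne', div_self hx0.ne']; ring

end Asymptotics

/-! ### Kissing configurations and the numerical constant -/

section Kissing

/-- The centres of a kissing configuration are twice the points of a spherical code of angle
`π / 3`. -/
theorem kissingNumber_eq_maxSphericalCode (d : ℕ) :
    kissingNumber d = maxSphericalCode d (Real.pi / 3) := by
  have hinj : ∀ a : ℝ, a ≠ 0 → Function.Injective fun x : EuclideanSpace ℝ (Fin d) => a • x :=
    fun a ha => smul_right_injective _ ha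
  have hsq : ∀ x y : EuclideanSpace ℝ (Fin d), ‖x‖ = 1 → ‖y‖ = 1 →
      (inner ℝ x y ≤ 1 / 2 ↔ 1 ≤ ‖x - y‖) := by
    intro x y hx hy
    have h := norm_sub_sq_real x y
    rw [hx, hy] at h
    constructor
    · intro hi
      nlinarith [norm_nonneg (x - y)]
    · intro hi
      nlinarith [norm_nonneg (x - y)]
  refine le_antisymm ?_ ?_
  · obtain ⟨C, hC, hcard⟩ := (isGreatest_kissingNumber d).1
    refine (isGreatest_maxSphericalCode d (by positivity) (by linarith [Real.pi_pos])).2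
      ⟨C.image fun x => (1 / 2 : ℝ) • x, ?_, ?_⟩
    · have hnorm : ∀ x ∈ C, ‖(1 / 2 : ℝ) • x‖ = 1 := by
        intro x hx
        obtain ⟨z, hz1, hz2⟩ := hC.touches x hx
        have h1 := (disjoint_ball_ball_iff one_pos one_pos).1 (hC.disjoint_central x hx)
        rw [Metric.mem_sphere] at hz1 hz2
        have h2 := dist_triangle_left x 0 z
        rw [hz1, hz2] at h2
        rw [dist_zero_right] at h1 h2
        rw [norm_smul, Real.norm_of_nonneg (by norm_num)]
        linarith
      refine ⟨?_, ?_⟩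
      · intro p hp
        obtain ⟨x, hx, rfl⟩ := Finset.mem_image.1 hp
        rw [mem_sphere_zero_iff_norm]
        exact hnorm x hx
      · intro p hp q hq hpq
        obtain ⟨x, hx, rfl⟩ := Finset.mem_image.1 hp
        obtain ⟨y, hy, rfl⟩ := Finset.mem_image.1 hq
        rw [Real.cos_pi_div_three, hsq _ _ (hnorm x hx) (hnorm y hy), ← smul_sub, norm_smul,
          Real.norm_of_nonneg (by norm_num), ← dist_eq_norm]
        have := (disjoint_ball_ball_iff one_pos one_pos).1
          (hC.pairwise_disjoint x hx y hy fun h => hpq (h ▸ rfl))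
        linarith
    · rw [Finset.card_image_of_injective _ (hinj _ (by norm_num)), hcard]
  · obtain ⟨C, hC, hcard⟩ := (isGreatest_maxSphericalCode d (θ := Real.pi / 3) (by positivity)
      (by linarith [Real.pi_pos])).1
    have hnorm : ∀ x ∈ C, ‖x‖ = 1 := fun x hx => mem_sphere_zero_iff_norm.1 (hC.mem_sphere x hx)
    refine (isGreatest_kissingNumber d).2 ⟨C.image fun x => (2 : ℝ) • x, ⟨?_, ?_, ?_⟩, ?_⟩
    · intro p hp
      obtain ⟨x, hx, rfl⟩ := Finset.mem_image.1 hp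
      refine ⟨x, ?_, hC.mem_sphere x hx⟩
      rw [Metric.mem_sphere, dist_eq_norm, two_smul, sub_add_cancel_left, norm_neg, hnorm x hx]
    · intro p hp
      obtain ⟨x, hx, rfl⟩ := Finset.mem_image.1 hp
      rw [disjoint_ball_ball_iff one_pos one_pos, dist_zero_right, norm_smul, hnorm x hx]
      norm_num
    · intro p hp q hq hpq
      obtain ⟨x, hx, rfl⟩ := Finset.mem_image.1 hp
      obtain ⟨y, hy, rfl⟩ := Finset.mem_image.1 hq
      have hi := hC.inner_le x hx y hy fun h => hpq (h ▸ rfl)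
      rw [Real.cos_pi_div_three, hsq _ _ (hnorm x hx) (hnorm y hy)] at hi
      rw [disjoint_ball_ball_iff one_pos one_pos, dist_eq_norm, ← smul_sub, norm_smul,
        Real.norm_of_nonneg (by norm_num)]
      linarith
    · rw [Finset.card_image_of_injective _ (hinj _ (by norm_num)), hcard]

end Kissing

/-- `log (3 / (2 * √2))` is half of `log (9 / 8)`, whose power series converges quickly. -/
theorem abs_const_sub_lt :
    |√(3 * Real.pi / 8) * Real.log (3 / (2 * √2)) - 0.0639| < 0.00005 := by
  have hlog : Real.log (3 / (2 * √2)) = -Real.log (1 - 1 / 9) / 2 := by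
    have h : (3 / (2 * √2)) ^ 2 = (1 - 1 / 9 : ℝ)⁻¹ := by
      rw [div_pow, mul_pow, Real.sq_sqrt (by norm_num)]; norm_num
    have := congrArg Real.log h
    rw [Real.log_pow, Real.log_inv] at this
    push_cast at this
    linarith
  have hb := Real.abs_log_sub_add_sum_range_le (x := 1 / 9) (by rw [abs_of_pos] <;> norm_num) 5
  rw [abs_le, abs_of_pos (by norm_num : (0 : ℝ) < 1 / 9)] at hb
  norm_num [Finset.sum_range_succ] at hb
  have h1 : 0.05889 < Real.log (3 / (2 * √2)) := by
    rw [hlog]; norm_num; linarith [hb.2]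
  have h2 : Real.log (3 / (2 * √2)) < 0.058893 := by
    rw [hlog]; norm_num; linarith [hb.1]
  have h3 : 1.0854 < √(3 * Real.pi / 8) := by
    refine Real.lt_sqrt_of_sq_lt ?_
    nlinarith [Real.pi_gt_d6]
  have h4 : √(3 * Real.pi / 8) < 1.0855 := by
    rw [Real.sqrt_lt' (by norm_num)]
    nlinarith [Real.pi_lt_d6]
  rw [abs_lt]
  constructor <;> nlinarith

theorem theorem1 :
    (∀ d : ℕ, kissingNumber d = maxSphericalCode d (Real.pi / 3)) ∧
    (∃ ε : ℕ → ℝ, Tendsto ε atTop (𝓝 0) ∧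
      ∀ᶠ d : ℕ in atTop,
        (1 + ε d) * (√(3 * Real.pi / 8) * Real.log (3 / (2 * √2)) * (d : ℝ) ^ (3 / 2 : ℝ) *
          (2 / √3) ^ d) ≤ (kissingNumber d : ℝ)) ∧
    |√(3 * Real.pi / 8) * Real.log (3 / (2 * √2)) - 0.0639| < 0.00005 := by
  refine ⟨kissingNumber_eq_maxSphericalCode, ⟨fun d => boundRatio d - 1, ?_, ?_⟩,
    abs_const_sub_lt⟩
  · simpa using (tendsto_boundRatio.comp tendsto_natCast_atTop_atTop).sub_const 1
  · filter_upwards [eventually_ge_atTop 2] with d hd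
    rw [add_sub_cancel, kissingNumber_eq_maxSphericalCode]
    exact boundRatio_mul_le hd
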